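/- Let $n,m,p$ be nonnegative integers and consider the problem of minimizing $f(x)$ over $x\in\mathbb{R}^n$ subject to $h_i(x)=0$ for $i=1,\dots,m$ and $g_j(x)\le 0$ for $j=1,\dots,p$, where $f,h_i,g_j:\mathbb{R}^n\to\mathbb{R}$ are twice continuously differentiable. Let $x^*$ be a local minimizer, let $A=\{j: g_j(x^*)=0\}$ and $q=|A|$, and let $J(x)\in\mathbb{R}^{(m+q)\times n}$ be the matrix whose rows are $\nabla h_i(x)^{\mathtt T}$, $i=1,\dots,m$, and $\nabla g_j(x)^{\mathtt T}$, $j\in A$. Assume the following. 1. (MFCQ) The vectors $\nabla h_1(x^*),\dots,\nabla h_m(x^*)$ are linearly independent and there is $d\in\mathbb{R}^n$ with $\nabla h_i(x^*)^{\mathtt T}d=0$ for all $i$ and $\nabla g_j(x^*)^{\mathtt T}d<0$ for all $j\in A$. 2. For every $x$ in some neighborhood of $x^*$, $\operatorname{rank}J(x)\le \operatorname{rank}J(x^*)+1$. 3. There are matrix functions $U(x)\in\mathbb{R}^{(m+q)\times(m+q)}$, $\Sigma(x)\in\mathbb{R}^{(m+q)\times n}$, $V(x)\in\mathbb{R}^{n\times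 n}$, differentiable in a neighborhood of $x^*$, such that for all $x$ in this neighborhood $J(x)=U(x)\Sigma(x)V(x)^{\mathtt T}$, the matrix $\Sigma(x)$ is diagonal with diagonal elements $\sigma_1(x),\dots,\sigma_{\min\{m+q,n\}}(x)$ (of any sign and in any order), and $\sigma_i(x)=0$ whenever $i>\operatorname{rank}J(x)$; moreover, the columns of $U(x^*)$ are non-zero and pairwise orthogonal, and so are those of $V(x^*)$. Then the weak second-order optimality condition (WSOC) holds at $x^*$: there are $\lambda\in\mathbb{R}^m$ and $\mu\in\mathbb{R}^p$ with $\mu\ge 0$ such that $$\nabla f(x^*)+\sum_{i=1}^m\lambda_i\nabla h_i(x^*)+\sum_{j=1}^p\mu_j\nabla g_j(x^*)=0,\qquad \mu_j g_j(x^*)=0\ \text{ for all } j,$$ and, for every $d\in\mathbb{R}^n$ with $\nabla h_i(x^*)^{\mathtt T}d=0$ for all $i$ and $\nabla g_j(x^*)^{\mathtt T}d=0$ for all $j\in A$, $$d^{\mathtt T}\Big(\nabla^2 f(x^*)+\sum_{i=1}^m\lambda_i\nabla^2 h_i(x^*)+\sum_{j=1}^p\mu_j\nabla^2 g_j(x^*)\Big)d\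 \ge\ 0 .$$ -/

import Mathlib

open Filter Topology

noncomputable section

/-- The data of the problem: minimize `f x` subject to `h i x = 0` for all `i` and `g j x ≤ 0` for
all `j`, with `x` in Euclidean `n`-space, `m` equality and `p` inequality constraints. -/
structure NLP (n m p : ℕ) where
  f : EuclideanSpace ℝ (Fin n) → ℝ
  h : Fin m → EuclideanSpace ℝ (Fin n) → ℝ
  g : Fin p → EuclideanSpace ℝ (Fin n) → ℝ

namespace NLP

variable {n m p : ℕ} (P : NLP n m p)

/-- All the functions of the problem are twice continuously differentiable. -/
def IsC2 : Prop :=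
  ContDiff ℝ 2 P.f ∧ (∀ i, ContDiff ℝ 2 (P.h i)) ∧ ∀ j, ContDiff ℝ 2 (P.g j)

/-- The feasible set `Ω`. -/
def feasibleSet : Set (EuclideanSpace ℝ (Fin n)) :=
  {x | (∀ i, P.h i x = 0) ∧ ∀ j, P.g j x ≤ 0}

/-- `x` is a local minimizer of the problem: it is feasible and minimizes `f` among the feasible
points of some neighbourhood of `x`. -/
def IsLocalMinimizer (x : EuclideanSpace ℝ (Fin n)) : Prop :=
  x ∈ P.feasibleSet ∧ IsLocalMinOn P.f P.feasibleSet x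

/-- The set `A(x)` of indices of the inequality constraints that are active at `x`. -/
def active (x : EuclideanSpace ℝ (Fin n)) : Finset (Fin p) :=
  Finset.univ.filter fun j => P.g j x = 0

/-- The Mangasarian-Fromovitz constraint qualification at a feasible point `x`. -/
def MFCQ (x : EuclideanSpace ℝ (Fin n)) : Prop :=
  x ∈ P.feasibleSet ∧
  LinearIndependent ℝ (fun i => gradient (P.h i) x) ∧
  ∃ d : EuclideanSpace ℝ (Fin n),
    (∀ i, inner ℝ (gradient (P.h i) x) d = 0) ∧
    ∀ j ∈ P.active x, inner ℝ (gradient (P.g j) x) d < 0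

/-- The matrix `J(x)`: its rows are the (transposed) gradients at `x` of all equality constraints,
followed by those of the inequality constraints that are active at the reference point `xs`. -/
def jacobian (xs x : EuclideanSpace ℝ (Fin n)) :
    Matrix (Fin m ⊕ {j // j ∈ P.active xs}) (Fin n) ℝ :=
  Matrix.of fun row k =>
    match row with
    | Sum.inl i => (gradient (P.h i) x) k
    | Sum.inr j => (gradient (P.g j) x) k

/-- The Lagrangian `L(x, lam, mu)`. -/
def lagrangian (lam : Fin m → ℝ) (mu : Fin p → ℝ) (x : EuclideanSpace ℝ (Fin n)) : ℝ :=
  P.f x + ∑ i, lam i * P.h i x + ∑ j, mu j * P.g j x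

/-- `(lam, mu)` is a Lagrange multiplier at the feasible point `x`. -/
def IsLagrangeMultiplier (x : EuclideanSpace ℝ (Fin n)) (lam : Fin m → ℝ) (mu : Fin p → ℝ) :
    Prop :=
  x ∈ P.feasibleSet ∧
  gradient (P.lagrangian lam mu) x = 0 ∧
  (∀ j, mu j * P.g j x = 0) ∧
  ∀ j, 0 ≤ mu j

/-- The critical subspace `S(x)`. -/
def criticalSubspace (x : EuclideanSpace ℝ (Fin n)) : Set (EuclideanSpace ℝ (Fin n)) :=
  {d | (∀ i, inner ℝ (gradient (P.h i) x) d = 0) ∧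
    ∀ j ∈ P.active x, inner ℝ (gradient (P.g j) x) d = 0}

/-- The quadratic form `dᵀ ∇²F(x) d` of the Hessian of `F` at `x`. -/
def hessianForm (F : EuclideanSpace ℝ (Fin n) → ℝ) (x d : EuclideanSpace ℝ (Fin n)) : ℝ :=
  fderiv ℝ (fderiv ℝ F) x d d

/-- The weak second-order optimality condition at `x`: one and the same Lagrange multiplier serves
all the directions of the critical subspace. -/
def WSOC (x : EuclideanSpace ℝ (Fin n)) : Prop :=
  ∃ (lam : Fin m → ℝ) (mu : Fin p → ℝ), P.IsLagrangeMultiplier x lam mu ∧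
    ∀ d ∈ P.criticalSubspace x, 0 ≤ hessianForm (P.lagrangian lam mu) x d

/-- The matrix `M` has non-zero, pairwise orthogonal columns. -/
def HasOrthogonalColumns {ι κ : Type*} [Fintype ι] (M : Matrix ι κ ℝ) : Prop :=
  (∀ j, M.col j ≠ 0) ∧ ∀ j j', j ≠ j' → M.col j ⬝ᵥ M.col j' = 0

/-- The matrix function `M` is differentiable at all points of a neighbourhood of `xs`
(that is, each of its finitely many entries is). -/
def DifferentiableNear {ι κ : Type*} (M : EuclideanSpace ℝ (Fin n) → Matrix ι κ ℝ)
    (xs : EuclideanSpace ℝ (Fin n)) : Prop :=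
  ∀ᶠ x in 𝓝 xs, ∀ i j, DifferentiableAt ℝ (fun y => M y i j) x

/-- `J` has a differentiable (weak) singular value decomposition `J(x) = U(x) Σ(x) V(x)ᵀ` around
`xs`. With `q` the number of active inequality constraints, `U` has `m + q` rows, indexed like the
rows of `J`, and `m + q` columns; `S`, which is `Σ`, is a diagonal rectangular matrix whose diagonal
entries vanish beyond the rank of `J(x)`. Indices start at `0`, so the diagonal entry in position
`(i, i)` is the `(i + 1)`-th one. -/
def HasDifferentiableSVD (xs : EuclideanSpace ℝ (Fin n)) : Prop :=
  ∃ (U : EuclideanSpace ℝ (Fin n) →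
        Matrix (Fin m ⊕ {j // j ∈ P.active xs}) (Fin (m + (P.active xs).card)) ℝ)
    (S : EuclideanSpace ℝ (Fin n) → Matrix (Fin (m + (P.active xs).card)) (Fin n) ℝ)
    (V : EuclideanSpace ℝ (Fin n) → Matrix (Fin n) (Fin n) ℝ),
    DifferentiableNear U xs ∧ DifferentiableNear S xs ∧ DifferentiableNear V xs ∧
    (∀ᶠ x in 𝓝 xs,
      P.jacobian xs x = U x * S x * (V x).transpose ∧
      (∀ (i : Fin (m + (P.active xs).card)) (k : Fin n), (i : ℕ) ≠ (k : ℕ) → S x i k = 0) ∧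
      (∀ (i : Fin (m + (P.active xs).card)) (k : Fin n), (i : ℕ) = (k : ℕ) →
        (P.jacobian xs x).rank < (i : ℕ) + 1 → S x i k = 0)) ∧
    HasOrthogonalColumns (U xs) ∧ HasOrthogonalColumns (V xs)

end NLP

end

/-!
# The weak second-order optimality condition under a rank-one increase of the Jacobian

The proof reduces the choice of one multiplier for all critical directions to Yuan's lemma on two
quadratic forms, because on the critical subspace the Hessians of the Lagrangians form a
one-parameter family.

* For a single critical direction `d`, MFCQ gives some multiplier whose Lagrangian has nonnegative
  curvature along `d` (`NLP.IsLocalMinimizer.exists_multiplier`). There is no acceleration `z` such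
  that a curve with velocity `d` and acceleration `z` stays in the set of the equality constraints
  and decreases the active constraints and the objective to second order, by the second derivative
  test along a curve from the implicit function theorem (`exists_curve_in_level_set`). A theorem of
  the alternative (`exists_multipliers_of_infeasible`) turns this into a multiplier.

* Let `q`, `q'` be two multipliers, and let `w` be the vector of their differences on the rows of
  the Jacobian `J`. Then `w` is in the left kernel of `J` at the minimizer, and the Hessians of the
  Lagrangians differ at a critical `d` by the derivative of `w ⬝ J(x) d` in the direction `d`. Write
  `J = U Σ Vᵀ`. The factors `(Uᵀ w) i` and `(Vᵀ d) i` vanish at the minimizer for the nonzero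
  singular values, and the rank assumption leaves a single other index, so that this derivative is
  `(ℓ q - ℓ q') * Q d` with `ℓ` linear (`exists_hasFDerivAt_dotProduct_mulVec`,
  `NLP.exists_hessianForm_lagrangian_sub`).

* Under MFCQ the set of multipliers is compact, so `ℓ` attains its minimum and its maximum there. At
  every critical direction the Hessian form of any multiplier is at most that of one of these two
  extreme multipliers, hence one of the two is nonnegative. Yuan's lemma
  (`exists_convexCombination_nonneg`) gives a convex combination of them that is nonnegative on the
  whole subspace, and the set of multipliers is convex.
-/

/-! ### Two quadratic forms -/

/-- Let one of two quadratic forms be nonnegative at every vector of a subspace, with `B` negative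
at `d` and `A` negative at `e`. Then, as `s` runs from `0` to `1`, the form `(1 - s) A + s B` turns
nonnegative at `e` no later than it turns negative at `d`; the inequality compares these two
parameters. Otherwise a form of the pencil is negative at both `d` and `e`, hence (after changing
the sign of `e`) on the whole segment between them, which the closed sets `{A ≥ 0}` and `{B ≥ 0}`
would then cover without meeting. -/
lemma mul_le_mul_of_forall_nonneg_or_nonneg {V : Type*} [AddCommGroup V] [Module ℝ V]
    (A B : V →ₗ[ℝ] V →ₗ[ℝ] ℝ) (S : Submodule ℝ V)
    (hAB : ∀ d ∈ S, 0 ≤ A d d ∨ 0 ≤ B d d) {d e : V} (hd : d ∈ S) (he : e ∈ S)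
    (hBd : B d d < 0) (hAe : A e e < 0) :
    A e e * B d d ≤ A d d * B e e := by
  by_contra! hlt
  have hAd : 0 ≤ A d d := (hAB d hd).resolve_right hBd.not_ge
  have hBe : 0 ≤ B e e := (hAB e he).resolve_left hAe.not_ge
  -- weights of a form of the pencil that is negative at both vectors
  obtain ⟨a, b, ha, hb, hMd, hMe⟩ : ∃ a b : ℝ, 0 < a ∧ 0 < b ∧
      a * A d d + b * B d d < 0 ∧ a * A e e + b * B e e < 0 := by
    refine ⟨B e e - B d d, A d d - A e e, by linarith, by linarith, ?_, ?_⟩ <;> nlinarith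
  wlog hpol : a * (A d e + A e d) + b * (B d e + B e d) ≤ 0 generalizing e
  · refine this (e := -e) (S.neg_mem he) ?_ ?_ ?_ ?_ ?_ <;> simp <;> first | assumption | linarith
  have hexp : ∀ (C : V →ₗ[ℝ] V →ₗ[ℝ] ℝ) (t : ℝ),
      C ((1 - t) • d + t • e) ((1 - t) • d + t • e) =
        (1 - t) ^ 2 * C d d + (1 - t) * t * (C d e + C e d) + t ^ 2 * C e e := by
    intro C t
    simp only [map_add, map_smul, LinearMap.add_apply, LinearMap.smul_apply, smul_eq_mul]
    ring
  have hcont : ∀ C : V →ₗ[ℝ] V →ₗ[ℝ] ℝ,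
      Continuous fun t : ℝ => C ((1 - t) • d + t • e) ((1 - t) • d + t • e) := by
    intro C
    simp only [hexp]
    fun_prop
  obtain ⟨t, ht, htA, htB⟩ := isPreconnected_closed_iff.mp
    (isPreconnected_Icc (a := (0 : ℝ)) (b := 1))
    {t | 0 ≤ A ((1 - t) • d + t • e) ((1 - t) • d + t • e)}
    {t | 0 ≤ B ((1 - t) • d + t • e) ((1 - t) • d + t • e)}
    (isClosed_le continuous_const (hcont A)) (isClosed_le continuous_const (hcont B))
    (fun t _ => hAB _ (S.add_mem (S.smul_mem _ hd) (S.smul_mem _ he)))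
    ⟨0, by simp, by simpa using hAd⟩ ⟨1, by simp, by simpa using hBe⟩
  simp only [Set.mem_ofPred_eq, hexp] at htA htB
  obtain ⟨ht0, ht1⟩ := ht
  have h1 : (1 - t) ^ 2 * (a * A d d + b * B d d) + t ^ 2 * (a * A e e + b * B e e) < 0 := by
    rcases eq_or_lt_of_le ht0 with rfl | h
    · simpa using hMd
    · have := mul_neg_of_pos_of_neg (pow_pos h 2) hMe
      have := mul_nonpos_of_nonneg_of_nonpos (sq_nonneg (1 - t)) hMd.le
      linarith
  have h2 := mul_nonpos_of_nonneg_of_nonpos (mul_nonneg (sub_nonneg.mpr ht1) ht0) hpol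
  have := mul_nonneg ha.le htA
  have := mul_nonneg hb.le htB
  linarith

/-- **Yuan's lemma** on a subspace: if at every vector one of two quadratic forms is nonnegative,
then one of their convex combinations is nonnegative everywhere. -/
theorem exists_convexCombination_nonneg {V : Type*} [AddCommGroup V] [Module ℝ V]
    (A B : V →ₗ[ℝ] V →ₗ[ℝ] ℝ) (S : Submodule ℝ V)
    (hAB : ∀ d ∈ S, 0 ≤ A d d ∨ 0 ≤ B d d) :
    ∃ s ∈ Set.Icc (0 : ℝ) 1, ∀ d ∈ S, 0 ≤ (1 - s) * A d d + s * B d d := by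
  by_cases hA : ∀ d ∈ S, 0 ≤ A d d
  · exact ⟨0, by simp, by simpa using hA⟩
  by_cases hB : ∀ d ∈ S, 0 ≤ B d d
  · exact ⟨1, by simp, by simpa using hB⟩
  push Not at hA hB
  obtain ⟨e₀, he₀, hAe₀⟩ := hA
  obtain ⟨d₀, hd₀, hBd₀⟩ := hB
  -- the parameters at which the pencil stops being negative at the vectors where `A` is negative
  let X : Set ℝ := {s | ∃ e ∈ S, A e e < 0 ∧ s = -A e e / (B e e - A e e)}
  have hpair : ∀ d ∈ S, B d d < 0 → ∀ s ∈ X, s ≤ A d d / (A d d - B d d) := by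
    rintro d hd hBd _ ⟨e, he, hAe, rfl⟩
    have hAd : 0 ≤ A d d := (hAB d hd).resolve_right hBd.not_ge
    have hBe : 0 ≤ B e e := (hAB e he).resolve_left hAe.not_ge
    rw [div_le_div_iff₀ (by linarith) (by linarith)]
    linarith [mul_le_mul_of_forall_nonneg_or_nonneg A B S hAB hd he hBd hAe]
  have hne : X.Nonempty := ⟨_, e₀, he₀, hAe₀, rfl⟩
  have hbdd : BddAbove X := ⟨_, hpair d₀ hd₀ hBd₀⟩
  have h0 : 0 ≤ sSup X := by
    have hBe : 0 ≤ B e₀ e₀ := (hAB e₀ he₀).resolve_left hAe₀.not_ge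
    exact le_trans (div_nonneg (by linarith) (by linarith)) (le_csSup hbdd ⟨e₀, he₀, hAe₀, rfl⟩)
  have h1 : sSup X ≤ 1 := by
    refine csSup_le hne fun s hs => (hpair d₀ hd₀ hBd₀ s hs).trans ?_
    have hAd : 0 ≤ A d₀ d₀ := (hAB d₀ hd₀).resolve_right hBd₀.not_ge
    exact div_le_one_of_le₀ (by linarith) (by linarith)
  refine ⟨sSup X, ⟨h0, h1⟩, fun d hd => ?_⟩
  by_cases hAd : 0 ≤ A d d
  · by_cases hBd : 0 ≤ B d d
    · exact add_nonneg (mul_nonneg (sub_nonneg.mpr h1) hAd) (mul_nonneg h0 hBd)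
    · have := csSup_le hne (hpair d hd (not_le.mp hBd))
      rw [le_div_iff₀ (by linarith)] at this
      linarith
  · have hBd : 0 ≤ B d d := (hAB d hd).resolve_left hAd
    have := le_csSup hbdd ⟨d, hd, not_le.mp hAd, rfl⟩
    rw [div_le_iff₀ (by linarith)] at this
    linarith

/-! ### A theorem of the alternative -/

/-- **Motzkin's alternative** for an affine system with strict inequalities and surjective
equations: if the system has no solution, then a nontrivial combination of its members is a
nonnegative constant. The set separated from the origin is open because the equations are
surjective, so that Hahn-Banach gives a strict inequality and hence a nonzero `μ`. -/
theorem exists_multipliers_of_infeasible {E F ι : Type*} [NormedAddCommGroup E] [NormedSpace ℝ E]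
    [NormedAddCommGroup F] [NormedSpace ℝ F] [FiniteDimensional ℝ F] [Fintype ι]
    (a : ι → E →L[ℝ] ℝ) (α : ι → ℝ) (B : E →L[ℝ] F) (β : F) (hB : Function.Surjective B)
    (hno : ¬ ∃ z, B z + β = 0 ∧ ∀ i, a i z + α i < 0) :
    ∃ (μ : ι → ℝ) (φ : F →L[ℝ] ℝ), (∀ i, 0 ≤ μ i) ∧ (∃ i, μ i ≠ 0) ∧
      (∀ z, ∑ i, μ i * a i z + φ (B z) = 0) ∧ 0 ≤ ∑ i, μ i * α i + φ β := by
  classical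
  obtain ⟨R, hR⟩ := B.exists_rightInverse_of_surjective (LinearMap.range_eq_top.mpr hB)
  have hR' : ∀ y, B (R y) = y := fun y => by
    simpa using congrArg (fun T : F →L[ℝ] F => T y) hR
  let K : Set ((ι → ℝ) × F) := {q | ∃ z, (∀ i, a i z + α i < q.1 i) ∧ B z + β = q.2}
  have hKopen : IsOpen K := by
    have : K = ⋃ k ∈ {k | B k = 0}, ⋂ i, {q | a i (R (q.2 - β) + k) + α i < q.1 i} := by
      ext q
      simp only [K, Set.mem_iUnion, Set.mem_iInter, Set.mem_ofPred_eq, exists_prop]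
      constructor
      · rintro ⟨z, hz, hq⟩
        refine ⟨z - R (q.2 - β), ?_, fun i => by simpa using hz i⟩
        rw [map_sub, hR', ← hq]; abel
      · rintro ⟨k, hk, hi⟩
        refine ⟨_, hi, ?_⟩
        rw [map_add, hR', hk]; abel
    rw [this]
    refine isOpen_biUnion fun k _ => isOpen_iInter_of_finite fun i => ?_
    exact isOpen_lt (by fun_prop) (by fun_prop)
  have hKconv : Convex ℝ K := by
    rintro q ⟨z, hz, hq⟩ q' ⟨z', hz', hq'⟩ s t hs ht hst
    refine ⟨s • z + t • z', fun i => ?_, ?_⟩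
    · have : a i (s • z + t • z') + α i = s * (a i z + α i) + t * (a i z' + α i) := by
        simp only [map_add, map_smul, smul_eq_mul]; linear_combination (-α i) * hst
      rw [this]
      simp only [Prod.fst_add, Prod.smul_fst, Pi.add_apply, Pi.smul_apply, smul_eq_mul]
      rcases hs.eq_or_lt with rfl | hs
      · have : t = 1 := by linarith
        subst this; simpa using hz' i
      · have := mul_lt_mul_of_pos_left (hz i) hs
        have := mul_le_mul_of_nonneg_left (hz' i).le ht
        linarith
    · simp only [map_add, map_smul, Prod.snd_add, Prod.smul_snd, ← hq, ← hq', smul_add]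
      have : β = s • β + t • β := by rw [← add_smul, hst, one_smul]
      nth_rewrite 1 [this]; abel
  have h0K : (0 : (ι → ℝ) × F) ∉ K := by
    rintro ⟨z, hz, hq⟩
    exact hno ⟨z, hq, hz⟩
  obtain ⟨ψ, hψ⟩ := geometric_hahn_banach_point_open hKconv hKopen h0K
  let μ : ι → ℝ := fun i => ψ (Pi.single i 1, 0)
  let φ : F →L[ℝ] ℝ := ψ.comp (ContinuousLinearMap.inr ℝ (ι → ℝ) F)
  have hrep : ∀ s e, ψ (s, e) = ∑ i, μ i * s i + φ e := by
    intro s e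
    have h1 : (s, e) = (s, (0 : F)) + ((0 : ι → ℝ), e) := by simp
    have h2 : ψ (s, (0 : F)) = ∑ i, μ i * s i := by
      have := LinearMap.pi_apply_eq_sum_univ
        (ψ.comp (ContinuousLinearMap.inl ℝ (ι → ℝ) F) : (ι → ℝ) →ₗ[ℝ] ℝ) s
      simp only [ContinuousLinearMap.coe_coe, ContinuousLinearMap.comp_apply,
        ContinuousLinearMap.inl_apply, smul_eq_mul] at this
      rw [this]
      refine Finset.sum_congr rfl fun i _ => ?_
      rw [mul_comm]
      congr 3
      ext j
      simp [Pi.single_apply, eq_comm]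
    rw [h1, map_add, h2]; rfl
  have hpos : ∀ z (r : ι → ℝ), (∀ i, 0 < r i) →
      0 < ∑ i, μ i * (a i z + α i + r i) + φ (B z + β) := by
    intro z r hr
    rw [← hrep]
    simpa using hψ _ ⟨z, fun i => by simpa using hr i, rfl⟩
  -- letting the slacks tend to `0`
  have hnn : ∀ z, 0 ≤ ∑ i, μ i * (a i z + α i) + φ (B z + β) := by
    intro z
    have hlim : Tendsto (fun ε : ℝ => ∑ i, μ i * (a i z + α i + ε) + φ (B z + β)) (𝓝[>] 0)
        (𝓝 (∑ i, μ i * (a i z + α i + 0) + φ (B z + β))) :=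
      (Continuous.tendsto (by fun_prop) 0).mono_left nhdsWithin_le_nhds
    simp only [add_zero] at hlim
    refine ge_of_tendsto hlim ?_
    filter_upwards [self_mem_nhdsWithin] with ε hε
    exact (hpos z (fun _ => ε) fun _ => hε).le
  -- an affine function bounded below is constant
  have hlin : ∀ z, ∑ i, μ i * a i z + φ (B z) = 0 := by
    have hc : ∀ z, ∑ i, μ i * (a i z + α i) + φ (B z + β) =
        (∑ i, μ i * a i z + φ (B z)) + (∑ i, μ i * α i + φ β) := by
      intro z; simp only [mul_add, Finset.sum_add_distrib, map_add]; ring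
    intro z
    set c := ∑ i, μ i * a i z + φ (B z) with hcdef
    set k := ∑ i, μ i * α i + φ β
    have hs : ∀ s : ℝ, 0 ≤ s * c + k := by
      intro s
      have := hnn (s • z)
      rw [hc] at this
      convert this using 2
      rw [hcdef, mul_add, Finset.mul_sum]
      simp only [map_smul, smul_eq_mul]
      congr 1
      exact Finset.sum_congr rfl fun i _ => by ring
    by_contra hne
    have := hs (-(k + 1) / c)
    rw [div_mul_cancel₀ _ hne] at this
    linarith
  refine ⟨μ, φ, fun i => ?_, ?_, hlin, ?_⟩
  · -- a negative weight would be exposed by a large slack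
    by_contra! hi
    have hk := hpos 0 1 fun _ => one_pos
    set k := ∑ i, μ i * (a i 0 + α i + (1 : ι → ℝ) i) + φ (B 0 + β)
    have := hpos 0 (1 + Pi.single i (-k / μ i)) fun j => by
      have hslack : (0 : ι → ℝ) ≤ Pi.single i (-k / μ i) :=
        Pi.single_nonneg.mpr (div_nonneg_of_nonpos (by linarith) hi.le)
      have := hslack j
      simp only [Pi.add_apply, Pi.one_apply, Pi.zero_apply] at this ⊢
      linarith
    have hsum : ∑ j, μ j * (Pi.single i (-k / μ i) : ι → ℝ) j = -k := by
      rw [Finset.sum_eq_single i]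
      · rw [Pi.single_eq_same, mul_div_cancel₀ _ hi.ne]
      · intro j _ hj; simp [hj]
      · simp
    simp only [Pi.add_apply, ← add_assoc, mul_add, Finset.sum_add_distrib] at this hsum
    rw [hsum] at this
    simp only [k, mul_add, Finset.sum_add_distrib] at this
    linarith
  · by_contra! hμ
    have := hpos 0 1 fun _ => one_pos
    -- with `μ = 0` the functional `φ` vanishes on the range of `B`, which is everything
    have hφ : ∀ y, φ y = 0 := fun y => by
      obtain ⟨z, rfl⟩ := hB y
      simpa [hμ] using hlin z
    simp [hμ, hφ] at this
  · have := hnn 0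
    simpa using this

/-! ### Curves in a level set -/

section Curves

variable {E F : Type*} [NormedAddCommGroup E] [NormedSpace ℝ E]
  [NormedAddCommGroup F] [NormedSpace ℝ F]

/-- The second derivative of a function along a curve. -/
lemma hasDerivAt_deriv_comp {h : E → F} (hh : ContDiff ℝ 2 h) {ξ : ℝ → E} {t : ℝ}
    (hξ : ContDiffAt ℝ 2 ξ t) :
    HasDerivAt (deriv (h ∘ ξ))
      (fderiv ℝ (fderiv ℝ h) (ξ t) (deriv ξ t) (deriv ξ t) + fderiv ℝ h (ξ t) (deriv (deriv ξ) t))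
      t := by
  have hξ1 : ∀ᶠ s in 𝓝 t, DifferentiableAt ℝ ξ s :=
    (hξ.eventually (by simp)).mono fun s hs => hs.differentiableAt (by norm_num)
  have hev : deriv (h ∘ ξ) =ᶠ[𝓝 t] fun s => fderiv ℝ h (ξ s) (deriv ξ s) := by
    filter_upwards [hξ1] with s hs
    exact fderiv_comp_deriv s (hh.differentiable (by norm_num) _) hs
  have hd2 : DifferentiableAt ℝ (deriv ξ) t :=
    (hξ.derivWithin (m := 1) (by norm_num)).differentiableAt (by norm_num)
  have hfd : DifferentiableAt ℝ (fderiv ℝ h) (ξ t) :=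
    (hh.fderiv_right (m := 1) (by norm_num)).differentiable (by norm_num) _
  have hc := hfd.hasFDerivAt.comp_hasDerivAt t (hξ1.self_of_nhds.hasDerivAt)
  exact (hc.clm_apply hd2.hasDerivAt).congr_of_eventuallyEq hev

/-- Where the derivative of `h` is surjective, a curve in the level set `h = 0` can be given any
velocity `d` and acceleration `z` that satisfy the equations obtained by differentiating
`h (ξ t) = 0` twice. -/
lemma exists_curve_in_level_set [CompleteSpace E] [FiniteDimensional ℝ F] {h : E → F}
    (hh : ContDiff ℝ 2 h) {x d z : E}
    (hsurj : Function.Surjective (fderiv ℝ h x)) (hx : h x = 0) (hd : fderiv ℝ h x d = 0)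
    (hz : fderiv ℝ h x z + fderiv ℝ (fderiv ℝ h) x d d = 0) :
    ∃ ξ : ℝ → E, ContDiffAt ℝ 2 ξ 0 ∧ ξ 0 = x ∧ deriv ξ 0 = d ∧ deriv (deriv ξ) 0 = z ∧
      ∀ᶠ t in 𝓝 0, h (ξ t) = 0 := by
  obtain ⟨B, hB⟩ := (fderiv ℝ h x).exists_rightInverse_of_surjective
    (LinearMap.range_eq_top.mpr hsurj)
  have hB' : ∀ y, fderiv ℝ h x (B y) = y := fun y => by
    simpa using congrArg (fun T : F →L[ℝ] F => T y) hB
  have : CompleteSpace F := FiniteDimensional.complete ℝ F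
  -- the parabola with velocity `d` and acceleration `z`, corrected by `B y`
  let f : ℝ × F → F := fun q => h (x + q.1 • d + (q.1 ^ 2 / 2) • z + B q.2)
  have hf : ContDiff ℝ 2 f := hh.comp (by fun_prop)
  have hf0 : f (0, 0) = 0 := by simp [f, hx]
  have hinr : fderiv ℝ f (0, 0) ∘L .inr ℝ ℝ F = ContinuousLinearMap.id ℝ F := by
    have h1 : HasFDerivAt (fun y => f (0, y)) (fderiv ℝ f (0, 0) ∘L .inr ℝ ℝ F) 0 :=
      ((hf.differentiable (by norm_num) _).hasFDerivAt).comp (0 : F) (hasFDerivAt_prodMk_right 0 0)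
    have h2 : HasFDerivAt (fun y => f (0, y)) (fderiv ℝ h x ∘L B) 0 := by
      have h3 : HasFDerivAt (fun y => x + B y) B 0 := B.hasFDerivAt.const_add x
      have h4 : HasFDerivAt h (fderiv ℝ h x) (x + B 0) := by
        simpa using (hh.differentiable (by norm_num) x).hasFDerivAt
      convert! h4.comp (0 : F) h3 using 1
      ext y; simp [f]
    rw [h1.unique h2, hB]
  have hinv : (fderiv ℝ f (0, 0) ∘L .inr ℝ ℝ F).IsInvertible := by
    rw [hinr]; exact ContinuousLinearMap.isInvertible_equiv (f := ContinuousLinearEquiv.refl ℝ F)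
  let y : ℝ → F := (hf.contDiffAt (x := ((0 : ℝ), (0 : F)))).implicitFunction (by norm_num) hinv
  have hy : ContDiffAt ℝ 2 y 0 := ContDiffAt.contDiffAt_implicitFunction _ _ _
  have hy0 : y 0 = 0 := ContDiffAt.implicitFunction_apply_self _ _ _
  have hyev : ∀ᶠ t in 𝓝 (0 : ℝ), f (t, y t) = 0 := by
    have := (hf.contDiffAt (x := ((0 : ℝ), (0 : F)))).eventually_apply_implicitFunction
      (by norm_num) hinv
    simpa only [hf0] using this
  let ξ : ℝ → E := fun t => x + t • d + (t ^ 2 / 2) • z + B (y t)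
  have hξ : ContDiffAt ℝ 2 ξ 0 := by fun_prop
  have hξ0 : ξ 0 = x := by simp [ξ, hy0]
  have hder : ∀ᶠ t in 𝓝 (0 : ℝ), deriv ξ t = d + t • z + B (deriv y t) := by
    filter_upwards [hy.eventually (by simp)] with t ht
    have h1 := (hasDerivAt_id t).smul_const d
    have h2 := (((hasDerivAt_id t).pow 2).div_const 2).smul_const z
    have h3 := B.hasFDerivAt.comp_hasDerivAt t (ht.differentiableAt (by norm_num)).hasDerivAt
    have h4 := ((h1.const_add x).add h2).add h3
    refine HasDerivAt.deriv (HasDerivAt.congr_deriv h4 ?_)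
    simp
  have hder2 : deriv (deriv ξ) 0 = z + B (deriv (deriv y) 0) := by
    rw [EventuallyEq.deriv_eq hder]
    have h1 := (hasDerivAt_id (0 : ℝ)).smul_const z
    have h3 := B.hasFDerivAt.comp_hasDerivAt (0 : ℝ)
      ((hy.derivWithin (m := 1) (by norm_num)).differentiableAt (by norm_num)).hasDerivAt
    refine HasDerivAt.deriv (HasDerivAt.congr_deriv ((h1.const_add d).add h3) ?_)
    simp
  have hzero : h ∘ ξ =ᶠ[𝓝 0] fun _ => 0 := hyev
  have hd0 : deriv ξ 0 = d := by
    have h1 := fderiv_comp_deriv (0 : ℝ) (hh.differentiable (by norm_num) (ξ 0))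
      (hξ.differentiableAt (by norm_num))
    rw [hzero.deriv_eq, hder.self_of_nhds, hξ0] at h1
    simp only [deriv_const, zero_smul, add_zero, map_add, hd, hB', zero_add] at h1
    simp [hder.self_of_nhds, ← h1]
  refine ⟨ξ, hξ, hξ0, hd0, ?_, hyev⟩
  have h1 := (hasDerivAt_deriv_comp hh hξ).deriv
  rw [hzero.deriv.deriv_eq, hξ0, hd0, hder2] at h1
  simp only [deriv_const', map_add, hB'] at h1
  have h2 : deriv (deriv y) 0 = 0 := by
    have h3 : deriv (deriv y) 0 = 0 - (fderiv ℝ h x z + fderiv ℝ (fderiv ℝ h) x d d) := by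
      rw [show (0 : F) = _ from h1]; abel
    rw [h3, hz, sub_zero]
  rw [hder2, h2, map_zero, add_zero]

end Curves

/-! ### Singular value decompositions -/

lemma NLP.HasOrthogonalColumns.eq_zero_of_mulVec_eq_zero {ι κ : Type*} [Fintype ι] [Fintype κ]
    {M : Matrix ι κ ℝ} (hM : NLP.HasOrthogonalColumns M) {y : κ → ℝ} (hy : M.mulVec y = 0) :
    y = 0 := by
  classical
  funext j
  have h1 : M.col j ⬝ᵥ M.mulVec y = (M.col j ⬝ᵥ M.col j) * y j := by
    rw [Matrix.dotProduct_mulVec, dotProduct, Finset.sum_eq_single j]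
    · rfl
    · intro k _ hk
      have : Matrix.vecMul (M.col j) M k = M.col j ⬝ᵥ M.col k := rfl
      rw [this, hM.2 j k hk.symm, zero_mul]
    · simp
  rw [hy, dotProduct_zero] at h1
  have h2 : M.col j ⬝ᵥ M.col j ≠ 0 := by
    rw [Ne, dotProduct_self_eq_zero]; exact hM.1 j
  exact (mul_eq_zero.mp h1.symm).resolve_left h2

lemma Matrix.rank_le_card_of_rows_eq_zero {k n : Type*} [Fintype k] [Fintype n] [DecidableEq k]
    (S : Matrix k n ℝ) (s : Finset k) (hS : ∀ i ∉ s, ∀ j, S i j = 0) : S.rank ≤ s.card := by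
  have hsub : LinearMap.range S.mulVecLin ≤
      Submodule.span ℝ ((s.image fun i => (Pi.single i 1 : k → ℝ) : Finset (k → ℝ)) : Set _) := by
    rintro _ ⟨v, rfl⟩
    have h1 : S.mulVecLin v = ∑ i ∈ s, S.mulVec v i • (Pi.single i 1 : k → ℝ) := by
      funext j
      simp only [Matrix.mulVecLin_apply, Finset.sum_apply, Pi.smul_apply, Pi.single_apply,
        smul_eq_mul, mul_ite, mul_one, mul_zero, Finset.sum_ite_eq]
      split_ifs with hj
      · rfl
      · simp [Matrix.mulVec, dotProduct, hS j hj]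
    rw [h1]
    refine Submodule.sum_mem _ fun i hi => Submodule.smul_mem _ _ (Submodule.subset_span ?_)
    simpa using ⟨i, hi, rfl⟩
  calc S.rank ≤ _ := Submodule.finrank_mono hsub
    _ ≤ (s.image fun i => (Pi.single i 1 : k → ℝ)).card := finrank_span_finset_le_card _
    _ ≤ s.card := Finset.card_image_le

/-- If `J = U S Vᵀ` with `S` rectangular diagonal, and the diagonal entries of `S` vanish beyond
the rank of `J`, then those before it do not: otherwise `S` would have too few nonzero rows. -/
lemma Matrix.diag_ne_zero_of_lt_rank {ρ : Type*} [Fintype ρ] {k n : ℕ} {J : Matrix ρ (Fin n) ℝ}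
    {U : Matrix ρ (Fin k) ℝ} {S : Matrix (Fin k) (Fin n) ℝ} {V : Matrix (Fin n) (Fin n) ℝ}
    (hJ : J = U * S * V.transpose)
    (hdiag : ∀ (i : Fin k) (j : Fin n), (i : ℕ) ≠ j → S i j = 0)
    (hvan : ∀ (i : Fin k) (j : Fin n), (i : ℕ) = j → J.rank < i + 1 → S i j = 0)
    {i : Fin k} {j : Fin n} (hij : (i : ℕ) = j) (hi : (i : ℕ) < J.rank) : S i j ≠ 0 := by
  intro h0
  let s : Finset (Fin k) := (Finset.univ.filter fun a : Fin k => (a : ℕ) < J.rank).erase i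
  have hS : S.rank ≤ s.card := by
    refine Matrix.rank_le_card_of_rows_eq_zero S s fun a ha b => ?_
    by_cases hab : (a : ℕ) = b
    · by_cases hai : a = i
      · have hbj : b = j := Fin.ext (by rw [← hab, ← hij, hai])
        rw [hai, hbj, h0]
      · refine hvan a b hab ?_
        by_contra hlt
        exact ha (by simp [s, hai]; omega)
    · exact hdiag a b hab
  have hJS : J.rank ≤ S.rank := by
    rw [hJ]
    exact (Matrix.rank_mul_le_left _ _).trans (Matrix.rank_mul_le_right _ _)
  have hcard : (Finset.univ.filter fun a : Fin k => (a : ℕ) < J.rank).card ≤ J.rank := by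
    have := Finset.card_le_card_of_injOn (s := Finset.univ.filter fun a : Fin k => (a : ℕ) < J.rank)
      (t := Finset.range J.rank) (fun a => (a : ℕ)) (by intro a; simp) Fin.val_injective.injOn
    simpa using this
  have hlt : s.card < (Finset.univ.filter fun a : Fin k => (a : ℕ) < J.rank).card :=
    Finset.card_erase_lt_of_mem (by simpa using hi)
  omega

/-- The derivative of `w ⬝ J(x) v` at `x₀`, for `w` in the left kernel and `v` in the kernel
of `J(x₀)`, when `J` has a differentiable singular value decomposition near `x₀` and its rank
increases by at most one: as a function of `w` it is a multiple `ℓ w` of a single functional.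

In `∑ i, (Uᵀ w) i * S i i * (Vᵀ v) i`, the factors `(Uᵀ w) i` and `(Vᵀ v) i` both vanish at `x₀`
where `S i i ≠ 0`, so that such a summand has derivative zero, while `S i i` is zero near `x₀` for
all indices beyond the rank of `J(x₀)` but the first one. -/
lemma exists_hasFDerivAt_dotProduct_mulVec {X ρ : Type*} [NormedAddCommGroup X] [NormedSpace ℝ X]
    [Fintype ρ] {k n : ℕ} {J : X → Matrix ρ (Fin n) ℝ} {x₀ : X} {U : X → Matrix ρ (Fin k) ℝ}
    {S : X → Matrix (Fin k) (Fin n) ℝ} {V : X → Matrix (Fin n) (Fin n) ℝ}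
    (hU : ∀ i j, DifferentiableAt ℝ (fun y => U y i j) x₀)
    (hS : ∀ i j, DifferentiableAt ℝ (fun y => S y i j) x₀)
    (hV : ∀ i j, DifferentiableAt ℝ (fun y => V y i j) x₀)
    (hJ : ∀ᶠ x in 𝓝 x₀, J x = U x * S x * (V x).transpose ∧
      (∀ (i : Fin k) (j : Fin n), (i : ℕ) ≠ j → S x i j = 0) ∧
      (∀ (i : Fin k) (j : Fin n), (i : ℕ) = j → (J x).rank < i + 1 → S x i j = 0))
    (hrank : ∀ᶠ x in 𝓝 x₀, (J x).rank ≤ (J x₀).rank + 1)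
    (hU₀ : NLP.HasOrthogonalColumns (U x₀)) (hV₀ : NLP.HasOrthogonalColumns (V x₀)) :
    ∃ (ℓ : (ρ → ℝ) →ₗ[ℝ] ℝ) (Q : (Fin n → ℝ) → X →L[ℝ] ℝ), ∀ w v,
      (J x₀).transpose.mulVec w = 0 → (J x₀).mulVec v = 0 →
      HasFDerivAt (fun x => w ⬝ᵥ (J x).mulVec v) (ℓ w • Q v) x₀ := by
  classical
  set r := (J x₀).rank with hr
  obtain ⟨hJ₀, hdiag₀, hvan₀⟩ := hJ.self_of_nhds
  -- the summand of index `(i, j)`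
  let T : (ρ → ℝ) → (Fin n → ℝ) → Fin k → Fin n → X → ℝ := fun w v i j x =>
    (U x).transpose.mulVec w i * S x i j * (V x).transpose.mulVec v j
  have hsum : ∀ w v, (fun x => w ⬝ᵥ (J x).mulVec v) =ᶠ[𝓝 x₀] fun x => ∑ i, ∑ j, T w v i j x := by
    intro w v
    filter_upwards [hJ] with x hx
    rw [hx.1, ← Matrix.mulVec_mulVec, ← Matrix.mulVec_mulVec, Matrix.dotProduct_mulVec,
      ← Matrix.mulVec_transpose, dotProduct]
    refine Finset.sum_congr rfl fun i _ => ?_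
    rw [show (S x).mulVec ((V x).transpose.mulVec v) i =
      ∑ j, S x i j * (V x).transpose.mulVec v j from rfl, Finset.mul_sum]
    exact Finset.sum_congr rfl fun j _ => by simp only [T]; ring
  have hUw : ∀ w i, DifferentiableAt ℝ (fun x => (U x).transpose.mulVec w i) x₀ := by
    intro w i
    simp only [Matrix.mulVec, dotProduct, Matrix.transpose_apply]
    fun_prop (disch := assumption)
  have hVv : ∀ v j, DifferentiableAt ℝ (fun x => (V x).transpose.mulVec v j) x₀ := by
    intro v j
    simp only [Matrix.mulVec, dotProduct, Matrix.transpose_apply]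
    fun_prop (disch := assumption)
  have hleft : ∀ w, (J x₀).transpose.mulVec w = 0 →
      ∀ (i : Fin k) (j : Fin n), (i : ℕ) = j → S x₀ i j ≠ 0 → (U x₀).transpose.mulVec w i = 0 := by
    intro w hw i j hij hne
    rw [hJ₀, Matrix.transpose_mul, Matrix.transpose_transpose, Matrix.transpose_mul,
      ← Matrix.mulVec_mulVec, ← Matrix.mulVec_mulVec] at hw
    have h1 := congrFun (hV₀.eq_zero_of_mulVec_eq_zero hw) j
    rw [Matrix.mulVec, dotProduct, Finset.sum_eq_single i] at h1
    · exact (mul_eq_zero.mp h1).resolve_left hne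
    · intro a _ ha
      rw [Matrix.transpose_apply, hdiag₀ a j fun h => ha (Fin.ext (h.trans hij.symm)), zero_mul]
    · simp
  have hright : ∀ v, (J x₀).mulVec v = 0 →
      ∀ (i : Fin k) (j : Fin n), (i : ℕ) = j → S x₀ i j ≠ 0 → (V x₀).transpose.mulVec v j = 0 := by
    intro v hv i j hij hne
    rw [hJ₀, Matrix.mul_assoc, ← Matrix.mulVec_mulVec, ← Matrix.mulVec_mulVec] at hv
    have h1 := congrFun (hU₀.eq_zero_of_mulVec_eq_zero hv) i
    rw [Matrix.mulVec, dotProduct, Finset.sum_eq_single j] at h1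
    · exact (mul_eq_zero.mp h1).resolve_left hne
    · intro a _ ha
      rw [hdiag₀ i a fun h => ha (Fin.ext (h.symm.trans hij)), zero_mul]
    · simp
  -- the summands other than the one of index `r` do not contribute
  have hT0 : ∀ w v, (J x₀).transpose.mulVec w = 0 → (J x₀).mulVec v = 0 →
      ∀ (i : Fin k) (j : Fin n), ¬ ((i : ℕ) = r ∧ (j : ℕ) = r) →
        HasFDerivAt (T w v i j) (0 : X →L[ℝ] ℝ) x₀ := by
    intro w v hw hv i j hne
    by_cases hij : (i : ℕ) = j
    · rcases lt_trichotomy (i : ℕ) r with hi | hi | hi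
      · have hSne := Matrix.diag_ne_zero_of_lt_rank hJ₀ hdiag₀ hvan₀ hij hi
        have h1 := ((hUw w i).hasFDerivAt.mul (hS i j).hasFDerivAt).mul (hVv v j).hasFDerivAt
        refine h1.congr_fderiv ?_
        simp [hleft w hw i j hij hSne, hright v hv i j hij hSne]
      · exact absurd ⟨hi, hij ▸ hi⟩ hne
      · refine (hasFDerivAt_const (0 : ℝ) x₀).congr_of_eventuallyEq ?_
        filter_upwards [hJ, hrank] with x hx hxr
        simp only [T]
        rw [hx.2.2 i j hij (by omega)]; ring
    · refine (hasFDerivAt_const (0 : ℝ) x₀).congr_of_eventuallyEq ?_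
      filter_upwards [hJ] with x hx
      simp only [T]
      rw [hx.2.1 i j hij]; ring
  by_cases hrk : r < k ∧ r < n
  · let a : Fin k := ⟨r, hrk.1⟩
    let b : Fin n := ⟨r, hrk.2⟩
    refine ⟨LinearMap.proj a ∘ₗ (U x₀).transpose.mulVecLin,
      fun v => (V x₀).transpose.mulVec v b • fderiv ℝ (fun x => S x a b) x₀,
      fun w v hw hv => ?_⟩
    have hab : S x₀ a b = 0 := hvan₀ a b rfl (by simp [a, hr])
    have h1 := ((hUw w a).hasFDerivAt.mul (hS a b).hasFDerivAt).mul (hVv v b).hasFDerivAt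
    have h2 : HasFDerivAt (T w v a b) (((U x₀).transpose.mulVec w a) •
        ((V x₀).transpose.mulVec v b • fderiv ℝ (fun x => S x a b) x₀)) x₀ := by
      refine h1.congr_fderiv ?_
      simp only [hab, Pi.mul_apply, mul_zero, zero_smul, add_zero, zero_add, smul_smul]
      rw [mul_comm]
    have h3 : HasFDerivAt (fun x => ∑ i, ∑ j, T w v i j x)
        (∑ i, ∑ j, if i = a ∧ j = b then (((U x₀).transpose.mulVec w a) •
        ((V x₀).transpose.mulVec v b • fderiv ℝ (fun x => S x a b) x₀)) else 0) x₀ := by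
      refine HasFDerivAt.fun_sum fun i _ => HasFDerivAt.fun_sum fun j _ => ?_
      split_ifs with hc
      · rw [hc.1, hc.2]; exact h2
      · exact hT0 w v hw hv i j fun h => hc ⟨Fin.ext h.1, Fin.ext h.2⟩
    refine (h3.congr_of_eventuallyEq (hsum w v)).congr_fderiv ?_
    rw [Finset.sum_eq_single a (by intro i _ hi; simp [hi]) (by simp),
      Finset.sum_eq_single b (by intro j _ hj; simp [hj]) (by simp),
      if_pos ⟨rfl, rfl⟩]
    rfl
  · refine ⟨0, fun _ => 0, fun w v hw hv => ?_⟩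
    have h3 : HasFDerivAt (fun x => ∑ i, ∑ j, T w v i j x)
        (∑ _i : Fin k, ∑ _j : Fin n, (0 : X →L[ℝ] ℝ)) x₀ :=
      HasFDerivAt.fun_sum fun i _ => HasFDerivAt.fun_sum fun j _ =>
        hT0 w v hw hv i j fun h => hrk ⟨h.1 ▸ i.2, h.2 ▸ j.2⟩
    refine (h3.congr_of_eventuallyEq (hsum w v)).congr_fderiv ?_
    simp

namespace NLP

variable {n m p : ℕ} {P : NLP n m p}

/-! ### The Lagrangian -/

lemma IsC2.fderiv_lagrangian (hC2 : P.IsC2) (lam : Fin m → ℝ) (mu : Fin p → ℝ) :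
    fderiv ℝ (P.lagrangian lam mu) = fun x =>
      fderiv ℝ P.f x + ∑ i, lam i • fderiv ℝ (P.h i) x + ∑ j, mu j • fderiv ℝ (P.g j) x := by
  funext x
  have hd : ∀ {F : EuclideanSpace ℝ (Fin n) → ℝ}, ContDiff ℝ 2 F → HasFDerivAt F (fderiv ℝ F x) x :=
    fun hF => (hF.differentiable (by norm_num) x).hasFDerivAt
  exact (((hd hC2.1).add (HasFDerivAt.fun_sum fun i _ => (hd (hC2.2.1 i)).const_mul (lam i))).add
    (HasFDerivAt.fun_sum fun j _ => (hd (hC2.2.2 j)).const_mul (mu j))).fderiv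

lemma IsC2.hessianForm_lagrangian (hC2 : P.IsC2) (lam : Fin m → ℝ) (mu : Fin p → ℝ)
    (x d : EuclideanSpace ℝ (Fin n)) :
    hessianForm (P.lagrangian lam mu) x d = hessianForm P.f x d +
      ∑ i, lam i * hessianForm (P.h i) x d + ∑ j, mu j * hessianForm (P.g j) x d := by
  have hd : ∀ {F : EuclideanSpace ℝ (Fin n) → ℝ}, ContDiff ℝ 2 F →
      HasFDerivAt (fderiv ℝ F) (fderiv ℝ (fderiv ℝ F) x) x := fun hF =>
    ((hF.fderiv_right (m := 1) (by norm_num)).differentiable (by norm_num) x).hasFDerivAt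
  have h := (((hd hC2.1).add (HasFDerivAt.fun_sum (u := Finset.univ)
    fun i _ => (hd (hC2.2.1 i)).const_smul (lam i))).add
    (HasFDerivAt.fun_sum (u := Finset.univ) fun j _ => (hd (hC2.2.2 j)).const_smul (mu j))).fderiv
  rw [hessianForm, hC2.fderiv_lagrangian]
  refine (congrArg (fun T => T d d) h).trans ?_
  simp [hessianForm]

lemma IsC2.isLagrangeMultiplier_iff (hC2 : P.IsC2) {x : EuclideanSpace ℝ (Fin n)}
    (hx : x ∈ P.feasibleSet) {lam : Fin m → ℝ} {mu : Fin p → ℝ} :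
    P.IsLagrangeMultiplier x lam mu ↔
      (∀ z, fderiv ℝ P.f x z + ∑ i, lam i * fderiv ℝ (P.h i) x z +
        ∑ j, mu j * fderiv ℝ (P.g j) x z = 0) ∧
      (∀ j, mu j * P.g j x = 0) ∧ ∀ j, 0 ≤ mu j := by
  rw [IsLagrangeMultiplier, gradient, LinearIsometryEquiv.map_eq_zero_iff, hC2.fderiv_lagrangian,
    ContinuousLinearMap.ext_iff]
  simp [hx]

lemma mem_active {x : EuclideanSpace ℝ (Fin n)} {j : Fin p} : j ∈ P.active x ↔ P.g j x = 0 := by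
  simp [active]

/-- The multipliers of inactive constraints vanish, so that sums weighted by multipliers run over
the active constraints. -/
lemma sum_mul_eq_sum_active {x : EuclideanSpace ℝ (Fin n)} {mu : Fin p → ℝ}
    (hmu : ∀ j, mu j * P.g j x = 0) (c : Fin p → ℝ) :
    ∑ j, mu j * c j = ∑ j : {j // j ∈ P.active x}, mu j * c j := by
  rw [Finset.sum_coe_sort (P.active x) fun j => mu j * c j]
  refine (Finset.sum_subset (Finset.subset_univ _) fun j _ hj => ?_).symm
  rw [(mul_eq_zero.mp (hmu j)).resolve_right fun h => hj (mem_active.mpr h), zero_mul]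

lemma mem_criticalSubspace_iff {x d : EuclideanSpace ℝ (Fin n)} :
    d ∈ P.criticalSubspace x ↔
      (∀ i, fderiv ℝ (P.h i) x d = 0) ∧ ∀ j ∈ P.active x, fderiv ℝ (P.g j) x d = 0 := by
  simp [criticalSubspace, inner_gradient_left]

/-- Along a critical direction, the objective has zero derivative at a point with a multiplier. -/
lemma IsC2.fderiv_eq_zero_of_mem_criticalSubspace (hC2 : P.IsC2) {x d : EuclideanSpace ℝ (Fin n)}
    {lam : Fin m → ℝ} {mu : Fin p → ℝ} (h : P.IsLagrangeMultiplier x lam mu)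
    (hd : d ∈ P.criticalSubspace x) : fderiv ℝ P.f x d = 0 := by
  rw [mem_criticalSubspace_iff] at hd
  obtain ⟨h1, h2, -⟩ := (hC2.isLagrangeMultiplier_iff h.1).mp h
  have := h1 d
  rw [sum_mul_eq_sum_active h2] at this
  simpa [hd.1, fun j : {j // j ∈ P.active x} => hd.2 j j.2] using this

/-! ### Second-order necessary conditions in a single direction -/

lemma IsC2.contDiff_equality (hC2 : P.IsC2) : ContDiff ℝ 2 fun x i => P.h i x :=
  contDiff_pi.mpr hC2.2.1

lemma IsC2.fderiv_equality (hC2 : P.IsC2) (x z : EuclideanSpace ℝ (Fin n)) (i : Fin m) :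
    fderiv ℝ (fun x i => P.h i x) x z i = fderiv ℝ (P.h i) x z := by
  rw [fderiv_pi fun i => (hC2.2.1 i).differentiable (by norm_num) x]
  rfl

lemma IsC2.fderiv_fderiv_equality (hC2 : P.IsC2) (x d : EuclideanSpace ℝ (Fin n)) (i : Fin m) :
    fderiv ℝ (fderiv ℝ fun x i => P.h i x) x d d i = hessianForm (P.h i) x d := by
  have hd : ∀ {G : Type} [NormedAddCommGroup G] [NormedSpace ℝ G]
      {F : EuclideanSpace ℝ (Fin n) → G}, ContDiff ℝ 2 F →
      HasFDerivAt (fun y => fderiv ℝ F y d)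
        ((fderiv ℝ (fderiv ℝ F) x).flip d) x := fun hF => by
    simpa using ((hF.fderiv_right (m := 1) (by norm_num)).differentiable
      (by norm_num) x).hasFDerivAt.clm_apply (hasFDerivAt_const d x)
  have h1 := (hasFDerivAt_pi'.mp (hd hC2.contDiff_equality)) i
  simp only [hC2.fderiv_equality] at h1
  exact congrArg (fun T => T d) (h1.unique (hd (hC2.2.1 i)))

/-- The derivative of the equality constraints is surjective when their gradients are linearly
independent. -/
lemma IsC2.surjective_fderiv_equality (hC2 : P.IsC2) {x : EuclideanSpace ℝ (Fin n)}
    (hli : LinearIndependent ℝ fun i => gradient (P.h i) x) :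
    Function.Surjective (fderiv ℝ (fun x i => P.h i x) x) := by
  rw [← ContinuousLinearMap.coe_coe, ← LinearMap.dualMap_injective_iff]
  refine (injective_iff_map_eq_zero _).mpr fun φ hφ => ?_
  have hsum : ∑ i, φ (Pi.single i 1) • gradient (P.h i) x = 0 := by
    refine ext_inner_right ℝ fun z => ?_
    rw [sum_inner, inner_zero_left]
    have h1 := congrArg (fun T => T z) hφ
    simp only [LinearMap.dualMap_apply, LinearMap.zero_apply, ContinuousLinearMap.coe_coe] at h1
    rw [LinearMap.pi_apply_eq_sum_univ φ] at h1
    rw [← h1]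
    refine Finset.sum_congr rfl fun i _ => ?_
    rw [inner_smul_left, inner_gradient_left, hC2.fderiv_equality, smul_eq_mul, mul_comm]
    simp only [conj_trivial]
    congr 2
    ext j
    simp [Pi.single_apply, eq_comm]
  have h0 := Fintype.linearIndependent_iff.mp hli _ hsum
  refine LinearMap.pi_ext' fun i => LinearMap.ext_ring ?_
  simpa using h0 i

/-- At a local minimizer where the gradients of the equality constraints are linearly independent,
there is no velocity `d` and acceleration `z` for which, to second order, the equality constraints
are kept while the active inequality constraints and the objective strictly decrease. -/
lemma IsLocalMinimizer.not_second_order_descent {x d z : EuclideanSpace ℝ (Fin n)}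
    (hmin : P.IsLocalMinimizer x) (hC2 : P.IsC2)
    (hli : LinearIndependent ℝ fun i => gradient (P.h i) x) (hd : d ∈ P.criticalSubspace x)
    (hfd : fderiv ℝ P.f x d = 0)
    (hz : ∀ i, fderiv ℝ (P.h i) x z + hessianForm (P.h i) x d = 0)
    (hg : ∀ j ∈ P.active x, fderiv ℝ (P.g j) x z + hessianForm (P.g j) x d < 0) :
    0 ≤ fderiv ℝ P.f x z + hessianForm P.f x d := by
  rw [mem_criticalSubspace_iff] at hd
  obtain ⟨hfeas, hloc⟩ := hmin
  obtain ⟨ξ, hξ, hξ0, hξd, hξz, hξh⟩ := exists_curve_in_level_set (d := d) (z := z)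
    hC2.contDiff_equality (hC2.surjective_fderiv_equality hli) (funext hfeas.1)
    (funext fun i => by simpa [hC2.fderiv_equality] using hd.1 i)
    (funext fun i => by
      simpa [hC2.fderiv_equality, hC2.fderiv_fderiv_equality] using hz i)
  -- the second derivative test for functions along the curve
  have htest : ∀ {F : EuclideanSpace ℝ (Fin n) → ℝ}, ContDiff ℝ 2 F → fderiv ℝ F x d = 0 →
      fderiv ℝ F x z + hessianForm F x d < 0 → IsLocalMax (F ∘ ξ) 0 := by
    intro F hF hFd hneg
    refine isLocalMax_of_deriv_deriv_neg ?_ ?_ (hF.continuous.continuousAt.comp hξ.continuousAt)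
    · rw [(hasDerivAt_deriv_comp hF hξ).deriv, hξ0, hξd, hξz, add_comm]; exact hneg
    · rw [fderiv_comp_deriv (0 : ℝ) (hF.differentiable (by norm_num) _)
        (hξ.differentiableAt (by norm_num)), hξ0, hξd, hFd]
  have hgle : ∀ j, ∀ᶠ t in 𝓝 (0 : ℝ), P.g j (ξ t) ≤ 0 := by
    intro j
    by_cases hj : j ∈ P.active x
    · filter_upwards [htest (hC2.2.2 j) (hd.2 j hj) (hg j hj)] with t ht
      have h0 := mem_active.mp hj
      simpa [hξ0, h0] using ht
    · have hlt : P.g j (ξ 0) < 0 := by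
        rw [hξ0]; exact lt_of_le_of_ne (hfeas.2 j) fun h => hj (mem_active.mpr h)
      have hc : ContinuousAt (fun t => P.g j (ξ t)) 0 :=
        (hC2.2.2 j).continuous.continuousAt.comp hξ.continuousAt
      exact (hc.eventually (gt_mem_nhds hlt)).mono fun t ht => le_of_lt ht
  have hmem : ∀ᶠ t in 𝓝 (0 : ℝ), ξ t ∈ P.feasibleSet := by
    filter_upwards [hξh, eventually_all.mpr hgle] with t h1 h2
    exact ⟨fun i => congrFun h1 i, h2⟩
  have hlow : ∀ᶠ t in 𝓝 (0 : ℝ), P.f x ≤ P.f (ξ t) := by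
    have htend : Tendsto ξ (𝓝 0) (𝓝[P.feasibleSet] x) :=
      tendsto_nhdsWithin_iff.mpr ⟨hξ0 ▸ hξ.continuousAt, hmem⟩
    exact htend.eventually hloc
  by_contra! hneg
  -- otherwise the objective is constant along the curve
  have hconst : P.f ∘ ξ =ᶠ[𝓝 0] fun _ => P.f x := by
    filter_upwards [htest hC2.1 hfd hneg, hlow] with t h1 h2
    exact le_antisymm (by simpa [hξ0] using h1) h2
  have h2 := (hasDerivAt_deriv_comp hC2.1 hξ).deriv
  rw [hconst.deriv.deriv_eq, hξ0, hξd, hξz] at h2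
  simp only [deriv_const'] at h2
  rw [hessianForm] at hneg
  linarith

lemma MFCQ.exists_fderiv {x : EuclideanSpace ℝ (Fin n)} (h : P.MFCQ x) :
    ∃ d : EuclideanSpace ℝ (Fin n), (∀ i, fderiv ℝ (P.h i) x d = 0) ∧
      ∀ j ∈ P.active x, fderiv ℝ (P.g j) x d < 0 := by
  simpa [inner_gradient_left] using h.2.2

/-- Under MFCQ, every critical direction along which the objective has zero derivative has a
multiplier whose Lagrangian has nonnegative curvature in that direction. It comes from the
alternative to the second-order descent system; MFCQ makes the weight of the objective nonzero. -/
theorem IsLocalMinimizer.exists_multiplier_of_fderiv_eq_zero {x d : EuclideanSpace ℝ (Fin n)}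
    (hmin : P.IsLocalMinimizer x) (hC2 : P.IsC2) (hM : P.MFCQ x) (hd : d ∈ P.criticalSubspace x)
    (hfd : fderiv ℝ P.f x d = 0) :
    ∃ lam mu, P.IsLagrangeMultiplier x lam mu ∧ 0 ≤ hessianForm (P.lagrangian lam mu) x d := by
  classical
  obtain ⟨μ, φ, hμ, ⟨k, hk⟩, hlin, hconst⟩ := exists_multipliers_of_infeasible
    (ι := Option {j // j ∈ P.active x})
    (fun o => o.elim (fderiv ℝ P.f x) fun j => fderiv ℝ (P.g j) x)
    (fun o => o.elim (hessianForm P.f x d) fun j => hessianForm (P.g j) x d)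
    (fderiv ℝ (fun x i => P.h i x) x) (fun i => hessianForm (P.h i) x d)
    (hC2.surjective_fderiv_equality hM.2.1) (by
      rintro ⟨z, hz, hneg⟩
      refine (hneg none).not_ge (hmin.not_second_order_descent hC2 hM.2.1 hd hfd (fun i => ?_)
        fun j hj => hneg (some ⟨j, hj⟩))
      have := congrFun hz i
      rwa [Pi.add_apply, hC2.fderiv_equality] at this)
  simp only [Fintype.sum_option, Option.elim_none, Option.elim_some] at hlin hconst
  have hφ : ∀ y, φ y = ∑ i, φ (Pi.single i 1) * y i := by
    intro y
    have := LinearMap.pi_apply_eq_sum_univ (φ : (Fin m → ℝ) →ₗ[ℝ] ℝ) y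
    simp only [ContinuousLinearMap.coe_coe, smul_eq_mul] at this
    rw [this]
    refine Finset.sum_congr rfl fun i _ => ?_
    rw [mul_comm]
    congr 2
    ext j
    simp [Pi.single_apply, eq_comm]
  obtain ⟨d₀, hd₀, hd₀'⟩ := hM.exists_fderiv
  have hμ0 : μ none ≠ 0 := by
    intro h0
    have h1 := hlin d₀
    rw [h0, hφ] at h1
    simp only [hC2.fderiv_equality, hd₀, mul_zero, Finset.sum_const_zero, add_zero, zero_mul,
      zero_add] at h1
    have h2 := (Finset.sum_eq_zero_iff_of_nonpos fun j _ =>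
      mul_nonpos_of_nonneg_of_nonpos (hμ (some j)) (hd₀' j j.2).le).mp h1
    cases k with
    | none => exact hk h0
    | some j => exact hk ((mul_eq_zero.mp (h2 j (Finset.mem_univ j))).resolve_right (hd₀' j j.2).ne)
  have hpos : 0 < μ none := lt_of_le_of_ne (hμ none) hμ0.symm
  let lam : Fin m → ℝ := fun i => φ (Pi.single i 1) / μ none
  let mu : Fin p → ℝ := fun j => if hj : j ∈ P.active x then μ (some ⟨j, hj⟩) / μ none else 0
  have hcompl : ∀ j, mu j * P.g j x = 0 := by
    intro j
    by_cases hj : j ∈ P.active x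
    · rw [mem_active.mp hj, mul_zero]
    · simp [mu, hj]
  have hmu : ∀ j : {j // j ∈ P.active x}, mu j = μ (some j) / μ none := fun j => by
    simp [mu]
  -- dividing by the weight of the objective
  have hscale : ∀ (a : ℝ) (b : Fin m → ℝ) (c : Fin p → ℝ),
      a + ∑ i, lam i * b i + ∑ j, mu j * c j =
        (μ none * a + ∑ j : {j // j ∈ P.active x}, μ (some j) * c j + φ b) / μ none := by
    intro a b c
    rw [sum_mul_eq_sum_active hcompl, hφ, add_div, add_div, mul_div_cancel_left₀ _ hμ0,
      Finset.sum_div, Finset.sum_div]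
    simp only [hmu, lam, div_mul_eq_mul_div]
    ring
  refine ⟨lam, mu, (hC2.isLagrangeMultiplier_iff hM.1).mpr ⟨fun z => ?_, hcompl, fun j => ?_⟩, ?_⟩
  · rw [hscale]
    have : (fun i => fderiv ℝ (P.h i) x z) = fderiv ℝ (fun x i => P.h i x) x z :=
      funext fun i => (hC2.fderiv_equality x z i).symm
    rw [this, hlin, zero_div]
  · by_cases hj : j ∈ P.active x
    · simpa [mu, hj] using div_nonneg (hμ _) hpos.le
    · simp [mu, hj]
  · rw [hC2.hessianForm_lagrangian, hscale]
    exact div_nonneg hconst hpos.le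

/-- Under MFCQ, every critical direction has a multiplier whose Lagrangian has nonnegative
curvature in that direction. -/
theorem IsLocalMinimizer.exists_multiplier {x d : EuclideanSpace ℝ (Fin n)}
    (hmin : P.IsLocalMinimizer x) (hC2 : P.IsC2) (hM : P.MFCQ x) (hd : d ∈ P.criticalSubspace x) :
    ∃ lam mu, P.IsLagrangeMultiplier x lam mu ∧ 0 ≤ hessianForm (P.lagrangian lam mu) x d := by
  -- the direction `0` provides a first multiplier
  obtain ⟨lam, mu, h, -⟩ := hmin.exists_multiplier_of_fderiv_eq_zero (d := 0) hC2 hM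
    (by simp [criticalSubspace]) (by simp)
  exact hmin.exists_multiplier_of_fderiv_eq_zero hC2 hM hd
    (hC2.fderiv_eq_zero_of_mem_criticalSubspace h hd)

/-! ### The set of multipliers -/

/-- The set of Lagrange multipliers at `x`. -/
def multiplierSet (P : NLP n m p) (x : EuclideanSpace ℝ (Fin n)) :
    Set ((Fin m → ℝ) × (Fin p → ℝ)) :=
  {q | P.IsLagrangeMultiplier x q.1 q.2}

lemma IsC2.convex_multiplierSet (hC2 : P.IsC2) {x : EuclideanSpace ℝ (Fin n)}
    (hx : x ∈ P.feasibleSet) : Convex ℝ (P.multiplierSet x) := by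
  intro q hq q' hq' s t hs ht hst
  obtain ⟨h1, h2, h3⟩ := (hC2.isLagrangeMultiplier_iff hx).mp hq
  obtain ⟨h1', h2', h3'⟩ := (hC2.isLagrangeMultiplier_iff hx).mp hq'
  refine (hC2.isLagrangeMultiplier_iff hx).mpr ⟨fun z => ?_, fun j => ?_, fun j => ?_⟩
  · have e : ∀ {k : ℕ} (u v c : Fin k → ℝ), ∑ i, (s • u + t • v) i * c i =
        s * ∑ i, u i * c i + t * ∑ i, v i * c i := by
      intro k u v c
      rw [Finset.mul_sum, Finset.mul_sum, ← Finset.sum_add_distrib]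
      exact Finset.sum_congr rfl fun i _ => by simp; ring
    simp only [Prod.fst_add, Prod.smul_fst, Prod.snd_add, Prod.smul_snd, e]
    linear_combination s * h1 z + t * h1' z - fderiv ℝ P.f x z * hst
  · simp only [Prod.snd_add, Prod.smul_snd, Pi.add_apply, Pi.smul_apply, smul_eq_mul]
    linear_combination s * h2 j + t * h2' j
  · exact add_nonneg (mul_nonneg hs (h3 j)) (mul_nonneg ht (h3' j))

/-- Under MFCQ the set of multipliers is compact: evaluating the multiplier equation at the MFCQ
direction bounds the inequality multipliers, and then linear independence bounds the others. -/
lemma IsC2.isCompact_multiplierSet (hC2 : P.IsC2) {x : EuclideanSpace ℝ (Fin n)}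
    (hM : P.MFCQ x) : IsCompact (P.multiplierSet x) := by
  have hset : P.multiplierSet x = {q | (∀ z, fderiv ℝ P.f x z +
      ∑ i, q.1 i * fderiv ℝ (P.h i) x z + ∑ j, q.2 j * fderiv ℝ (P.g j) x z = 0) ∧
      (∀ j, q.2 j * P.g j x = 0) ∧ ∀ j, 0 ≤ q.2 j} :=
    Set.ext fun q => hC2.isLagrangeMultiplier_iff hM.1
  obtain ⟨d₀, hd₀, hd₀'⟩ := hM.exists_fderiv
  rw [Metric.isCompact_iff_isClosed_bounded]
  constructor
  · rw [hset]
    simp only [Set.ofPred_and, Set.ofPred_forall]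
    refine (isClosed_iInter fun z => isClosed_eq (by fun_prop) continuous_const).inter
      ((isClosed_iInter fun j => isClosed_eq (by fun_prop) continuous_const).inter
        (isClosed_iInter fun j => isClosed_le continuous_const (by fun_prop)))
  · -- the inequality multipliers
    have hmu : ∃ C, 0 ≤ C ∧ ∀ q ∈ P.multiplierSet x, ‖q.2‖ ≤ C := by
      have hj : ∀ j, ∃ C, ∀ q ∈ P.multiplierSet x, q.2 j ≤ C := by
        intro j
        by_cases hj : j ∈ P.active x
        · refine ⟨fderiv ℝ P.f x d₀ / -fderiv ℝ (P.g j) x d₀, fun q hq => ?_⟩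
          obtain ⟨h1, h2, h3⟩ := (hC2.isLagrangeMultiplier_iff hM.1).mp hq
          have h4 := h1 d₀
          simp only [hd₀, mul_zero, Finset.sum_const_zero, add_zero] at h4
          rw [sum_mul_eq_sum_active h2] at h4
          have h5 := Finset.single_le_sum (f := fun j : {j // j ∈ P.active x} =>
            -(q.2 j * fderiv ℝ (P.g j) x d₀)) (fun j _ => neg_nonneg.mpr
              (mul_nonpos_of_nonneg_of_nonpos (h3 j) (hd₀' j j.2).le)) (Finset.mem_univ ⟨j, hj⟩)
          simp only [Finset.sum_neg_distrib] at h5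
          rw [le_div_iff₀ (neg_pos.mpr (hd₀' j hj))]
          linarith
        · refine ⟨0, fun q hq => ?_⟩
          have h2 := ((hC2.isLagrangeMultiplier_iff hM.1).mp hq).2.1 j
          exact ((mul_eq_zero.mp h2).resolve_right fun h => hj (mem_active.mpr h)).le
      choose C hC using hj
      refine ⟨∑ j, |C j|, Finset.sum_nonneg fun j _ => abs_nonneg _, fun q hq => ?_⟩
      refine (pi_norm_le_iff_of_nonneg (Finset.sum_nonneg fun j _ => abs_nonneg _)).mpr fun j => ?_
      rw [Real.norm_eq_abs, abs_of_nonneg (((hC2.isLagrangeMultiplier_iff hM.1).mp hq).2.2 j)]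
      exact (hC j q hq).trans ((le_abs_self _).trans
        (Finset.single_le_sum (f := fun j => |C j|) (fun j _ => abs_nonneg _) (Finset.mem_univ j)))
    obtain ⟨C, hC0, hC⟩ := hmu
    -- the equality multipliers
    let T : (Fin m → ℝ) →ₗ[ℝ] (EuclideanSpace ℝ (Fin n) →L[ℝ] ℝ) :=
      Fintype.linearCombination ℝ fun i => fderiv ℝ (P.h i) x
    let R : (Fin p → ℝ) →L[ℝ] (EuclideanSpace ℝ (Fin n) →L[ℝ] ℝ) :=
      LinearMap.toContinuousLinearMap (Fintype.linearCombination ℝ fun j => fderiv ℝ (P.g j) x)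
    have hT : LinearMap.ker T = ⊥ := by
      refine LinearMap.ker_eq_bot'.mpr fun lam hlam => ?_
      refine funext (Fintype.linearIndependent_iff.mp hM.2.1 lam ?_)
      refine ext_inner_right ℝ fun z => ?_
      have := congrArg (fun T => T z) hlam
      simpa [T, Fintype.linearCombination_apply, sum_inner, inner_smul_left, inner_gradient_left]
        using this
    obtain ⟨K, -, hK⟩ := T.exists_antilipschitzWith hT
    refine (isBounded_iff_forall_norm_le).mpr
      ⟨max (K * (‖fderiv ℝ P.f x‖ + ‖R‖ * C)) C, fun q hq => ?_⟩
    refine (max_le_max ?_ (hC q hq)).trans' (Prod.norm_def q).le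
    obtain ⟨h1, -, -⟩ := (hC2.isLagrangeMultiplier_iff hM.1).mp hq
    have h2 : T q.1 = -(fderiv ℝ P.f x + R q.2) := by
      ext z
      have := h1 z
      simp only [T, R, LinearMap.coe_toContinuousLinearMap', Fintype.linearCombination_apply,
        sum_apply, smul_apply, neg_apply, add_apply, smul_eq_mul]
      linarith
    calc ‖q.1‖ ≤ K * ‖T q.1‖ := by simpa using hK.le_mul_dist q.1 0
      _ ≤ K * (‖fderiv ℝ P.f x‖ + ‖R‖ * C) := by
        refine mul_le_mul_of_nonneg_left ?_ K.2
        rw [h2, norm_neg]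
        refine (norm_add_le _ _).trans (add_le_add_right ?_ _)
        exact (R.le_opNorm _).trans (mul_le_mul_of_nonneg_left (hC q hq) (norm_nonneg _))

/-! ### The Hessians of the Lagrangians on the critical subspace -/

lemma jacobian_mulVec (xs x d : EuclideanSpace ℝ (Fin n)) :
    (P.jacobian xs x).mulVec d = Sum.elim (fun i => fderiv ℝ (P.h i) x d)
      fun j : {j // j ∈ P.active xs} => fderiv ℝ (P.g j) x d := by
  have hin : ∀ F : EuclideanSpace ℝ (Fin n) → ℝ,
      ∑ k, (gradient F x) k * d k = fderiv ℝ F x d := by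
    intro F
    rw [← inner_gradient_left (𝕜 := ℝ), PiLp.inner_apply]
    exact Finset.sum_congr rfl fun k _ => by simp [mul_comm]
  funext row
  cases row with
  | inl i => exact hin (P.h i)
  | inr j => exact hin (P.g j)

/-- The multipliers of the rows of the Jacobian, that is, of the equality constraints and of the
active inequality constraints. -/
def rowMultipliers (P : NLP n m p) (xs : EuclideanSpace ℝ (Fin n)) :
    ((Fin m → ℝ) × (Fin p → ℝ)) →ₗ[ℝ] (Fin m ⊕ {j // j ∈ P.active xs} → ℝ) :=
  LinearMap.pi fun row =>
    match row with
    | Sum.inl i => LinearMap.proj i ∘ₗ LinearMap.fst ℝ _ _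
    | Sum.inr j => LinearMap.proj j.1 ∘ₗ LinearMap.snd ℝ _ _

lemma rowMultipliers_dotProduct {xs : EuclideanSpace ℝ (Fin n)} {q : (Fin m → ℝ) × (Fin p → ℝ)}
    (hq : ∀ j, q.2 j * P.g j xs = 0) (b : Fin m → ℝ) (c : Fin p → ℝ) :
    P.rowMultipliers xs q ⬝ᵥ Sum.elim b (fun j : {j // j ∈ P.active xs} => c j) =
      ∑ i, q.1 i * b i + ∑ j, q.2 j * c j := by
  rw [sum_mul_eq_sum_active hq, dotProduct, Fintype.sum_sum_type]
  rfl

/-- Under the rank and singular value assumptions, the Hessians of the Lagrangians of any two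
multipliers differ on the critical subspace by a multiple, linear in the multipliers, of a single
function of the direction. -/
lemma exists_hessianForm_lagrangian_sub {xs : EuclideanSpace ℝ (Fin n)} (hC2 : P.IsC2)
    (hrank : ∀ᶠ x in 𝓝 xs, (P.jacobian xs x).rank ≤ (P.jacobian xs xs).rank + 1)
    (hSVD : P.HasDifferentiableSVD xs) :
    ∃ (ℓ : ((Fin m → ℝ) × (Fin p → ℝ)) →ₗ[ℝ] ℝ) (Q : EuclideanSpace ℝ (Fin n) → ℝ),
      ∀ q ∈ P.multiplierSet xs, ∀ q' ∈ P.multiplierSet xs, ∀ d ∈ P.criticalSubspace xs,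
        hessianForm (P.lagrangian q.1 q.2) xs d - hessianForm (P.lagrangian q'.1 q'.2) xs d =
          (ℓ q - ℓ q') * Q d := by
  obtain ⟨U, S, V, hU, hS, hV, hJ, hU₀, hV₀⟩ := hSVD
  obtain ⟨ℓ, Q, hQ⟩ := exists_hasFDerivAt_dotProduct_mulVec hU.self_of_nhds hS.self_of_nhds
    hV.self_of_nhds hJ hrank hU₀ hV₀
  refine ⟨ℓ ∘ₗ P.rowMultipliers xs, fun d => Q d d, fun q hq q' hq' d hd => ?_⟩
  obtain ⟨h1, h2, -⟩ := (hC2.isLagrangeMultiplier_iff hq.1).mp hq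
  obtain ⟨h1', h2', -⟩ := (hC2.isLagrangeMultiplier_iff hq.1).mp hq'
  have hsub : ∀ j, (q - q').2 j * P.g j xs = 0 := by
    intro j
    simp only [Prod.snd_sub, Pi.sub_apply]
    linear_combination h2 j - h2' j
  have hsplit : ∀ (b : Fin m → ℝ) (c : Fin p → ℝ),
      ∑ i, (q - q').1 i * b i + ∑ j, (q - q').2 j * c j =
      (∑ i, q.1 i * b i + ∑ j, q.2 j * c j) - (∑ i, q'.1 i * b i + ∑ j, q'.2 j * c j) := by
    intro b c
    simp only [Prod.fst_sub, Prod.snd_sub, Pi.sub_apply, sub_mul, Finset.sum_sub_distrib]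
    ring
  have hw : (P.jacobian xs xs).transpose.mulVec (P.rowMultipliers xs (q - q')) = 0 := by
    refine dotProduct_eq_zero _ fun v => ?_
    rw [Matrix.mulVec_transpose, ← Matrix.dotProduct_mulVec]
    have := P.jacobian_mulVec xs xs (WithLp.toLp 2 v)
    rw [show (P.jacobian xs xs).mulVec v = _ from this,
      rowMultipliers_dotProduct hsub _ fun j => fderiv ℝ (P.g j) xs (WithLp.toLp 2 v), hsplit]
    linear_combination h1 (WithLp.toLp 2 v) - h1' (WithLp.toLp 2 v)
  have hv : (P.jacobian xs xs).mulVec d = 0 := by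
    rw [mem_criticalSubspace_iff] at hd
    rw [jacobian_mulVec]
    funext row
    cases row with
    | inl i => exact hd.1 i
    | inr j => exact hd.2 j j.2
  have hder := hQ _ _ hw hv
  have hrow : ∀ y, P.rowMultipliers xs (q - q') ⬝ᵥ (P.jacobian xs y).mulVec d =
      ∑ i, (q - q').1 i * fderiv ℝ (P.h i) y d + ∑ j, (q - q').2 j * fderiv ℝ (P.g j) y d :=
    fun y => by
      rw [jacobian_mulVec]
      exact rowMultipliers_dotProduct hsub (fun i => fderiv ℝ (P.h i) y d)
        fun j => fderiv ℝ (P.g j) y d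
  simp only [hrow] at hder
  have hF : ∀ {F : EuclideanSpace ℝ (Fin n) → ℝ}, ContDiff ℝ 2 F →
      HasFDerivAt (fun y => fderiv ℝ F y d) ((fderiv ℝ (fderiv ℝ F) xs).flip d) xs := fun hF => by
    simpa using ((hF.fderiv_right (m := 1) (by norm_num)).differentiable
      (by norm_num) xs).hasFDerivAt.clm_apply (hasFDerivAt_const d xs)
  have hder' := (HasFDerivAt.fun_sum (u := Finset.univ) fun i _ =>
    (hF (hC2.2.1 i)).const_mul ((q - q').1 i)).add (HasFDerivAt.fun_sum (u := Finset.univ)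
      fun j _ => (hF (hC2.2.2 j)).const_mul ((q - q').2 j))
  have h := congrArg (fun T => T d) (hder'.unique hder)
  simp only [add_apply, sum_apply, smul_apply, ContinuousLinearMap.flip_apply, smul_eq_mul] at h
  rw [hsplit] at h
  simp only [LinearMap.comp_apply]
  rw [← map_sub, ← map_sub, ← h, hC2.hessianForm_lagrangian, hC2.hessianForm_lagrangian]
  simp only [hessianForm]
  ring

end NLP

/-! ### The weak second-order optimality condition -/

theorem theorem3p2 {n m p : ℕ} (P : NLP n m p) (hC2 : P.IsC2)
    (xs : EuclideanSpace ℝ (Fin n))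
    (hmin : P.IsLocalMinimizer xs)
    (hMFCQ : P.MFCQ xs)
    (hrank : ∀ᶠ x in 𝓝 xs, (P.jacobian xs x).rank ≤ (P.jacobian xs xs).rank + 1)
    (hSVD : P.HasDifferentiableSVD xs) :
    P.WSOC xs := by
  obtain ⟨ℓ, Q, hℓ⟩ := NLP.exists_hessianForm_lagrangian_sub hC2 hrank hSVD
  have hcompact := hC2.isCompact_multiplierSet hMFCQ
  have hne : (P.multiplierSet xs).Nonempty := by
    obtain ⟨lam, mu, h, -⟩ := hmin.exists_multiplier (d := 0) hC2 hMFCQ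
      (by simp [NLP.criticalSubspace])
    exact ⟨(lam, mu), h⟩
  have hcont : ContinuousOn ℓ (P.multiplierSet xs) :=
    (LinearMap.continuous_of_finiteDimensional ℓ).continuousOn
  -- the two extreme multipliers
  obtain ⟨a, ha, hamin⟩ := hcompact.exists_isMinOn hne hcont
  obtain ⟨b, hb, hbmax⟩ := hcompact.exists_isMaxOn hne hcont
  let C : Submodule ℝ (EuclideanSpace ℝ (Fin n)) :=
    { carrier := P.criticalSubspace xs
      zero_mem' := by simp [NLP.criticalSubspace]
      add_mem' := fun hd he => by
        rw [NLP.mem_criticalSubspace_iff] at *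
        exact ⟨fun i => by simp [hd.1 i, he.1 i], fun j hj => by simp [hd.2 j hj, he.2 j hj]⟩
      smul_mem' := fun t d hd => by
        rw [NLP.mem_criticalSubspace_iff] at *
        exact ⟨fun i => by simp [hd.1 i], fun j hj => by simp [hd.2 j hj]⟩ }
  let H : ((Fin m → ℝ) × (Fin p → ℝ)) →
      EuclideanSpace ℝ (Fin n) →ₗ[ℝ] EuclideanSpace ℝ (Fin n) →ₗ[ℝ] ℝ := fun q =>
    ContinuousLinearMap.coeLM ℝ ∘ₗ
      (fderiv ℝ (fderiv ℝ (P.lagrangian q.1 q.2)) xs).toLinearMap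
  obtain ⟨s, hs, hsH⟩ := exists_convexCombination_nonneg (H a) (H b) C fun d hd => by
    obtain ⟨lam, mu, hq, hpos⟩ := hmin.exists_multiplier hC2 hMFCQ hd
    have hqa := hℓ (lam, mu) hq a ha d hd
    have hqb := hℓ (lam, mu) hq b hb d hd
    have hle : ℓ a ≤ ℓ (lam, mu) := hamin hq
    have hge : ℓ (lam, mu) ≤ ℓ b := hbmax hq
    change 0 ≤ NLP.hessianForm (P.lagrangian a.1 a.2) xs d ∨
      0 ≤ NLP.hessianForm (P.lagrangian b.1 b.2) xs d
    rcases le_total 0 (Q d) with hQ | hQ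
    · right
      have := mul_nonpos_of_nonpos_of_nonneg (sub_nonpos.mpr hge) hQ
      linarith
    · left
      have := mul_nonpos_of_nonneg_of_nonpos (sub_nonneg.mpr hle) hQ
      linarith
  refine ⟨_, _, hC2.convex_multiplierSet hMFCQ.1 ha hb (sub_nonneg.mpr hs.2) hs.1
    (sub_add_cancel 1 s), fun d hd => ?_⟩
  have h := hsH d hd
  change 0 ≤ (1 - s) * NLP.hessianForm (P.lagrangian a.1 a.2) xs d +
    s * NLP.hessianForm (P.lagrangian b.1 b.2) xs d at h
  have e : ∀ {k : ℕ} (u v c : Fin k → ℝ), ∑ i, ((1 - s) • u + s • v) i * c i =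
      (1 - s) * ∑ i, u i * c i + s * ∑ i, v i * c i := by
    intro k u v c
    rw [Finset.mul_sum, Finset.mul_sum, ← Finset.sum_add_distrib]
    exact Finset.sum_congr rfl fun i _ => by simp; ring
  rw [hC2.hessianForm_lagrangian] at h ⊢
  rw [hC2.hessianForm_lagrangian] at h
  simp only [Prod.fst_add, Prod.smul_fst, Prod.snd_add, Prod.smul_snd, e]
  linarith
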